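/- Let $\mathcal L$ be the propositional modal language with countably many propositional variables and formulas $A ::= p \mid \bot \mid A\land A \mid A\lor A \mid A\to A \mid \Box A \mid \Diamond A$; put $\top := \bot\to\bot$ and $\neg A := A\to\bot$. Consider the modal axiom schemes - $\mathrm{dual}_\land$: $\neg(\Box A\land\Diamond\neg A)$; - $N_\Box$: $\Box\top$; - $C_\Box$: $\Box A\land\Box B\to\Box(A\land B)$; - $K_\Diamond$: $\Box(A\to B)\to(\Diamond A\to\Diamond B)$; - $P_\Diamond$: $\Diamond\top$; - $D$: $\Box A\to\Diamond A$; - $T_\Box$: $\Box A\to A$; - $T_\Diamond$: $A\to\Diamond A$. The *W-logics* are the following fourteen axiom systems. $\mathsf{WM}$ extends a Hilbert-style axiomatisation (axiom schemes and modus ponens) of intuitionistic propositional logic in the language $\mathcal L$ by $\mathrm{dual}_\land$ and the two rules "from $A\to B$ infer $\Box A\to\Box B$" and "from $A\to B$ infer $\Diamond A\to\Diamond B$". Further, $\mathsf{WMN}=\mathsf{WM}+N_\Box$, $\mathsf{WMC}=\mathsf{WM}+C_\Box+K_\Diamond$, $\mathsf{WK}=\mathsf{WMC}+N_\Box$, $\mathsf{WMP}=\mathsf{WM}+P_\Diamond$,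 $\mathsf{WMNP}=\mathsf{WMN}+P_\Diamond$, $\mathsf{WMD}=\mathsf{WM}+D+P_\Diamond$, $\mathsf{WMND}=\mathsf{WMN}+D$, $\mathsf{WMCD}=\mathsf{WMC}+D+P_\Diamond$, $\mathsf{WKD}=\mathsf{WK}+D$, and $\mathsf{WMT},\mathsf{WMNT},\mathsf{WMCT},\mathsf{WKT}$ are $\mathsf{WM},\mathsf{WMN},\mathsf{WMC},\mathsf{WK}$, respectively, $+\,T_\Box+T_\Diamond$. Write $\mathsf{WL}\vdash A$ if $A$ is a theorem of $\mathsf{WL}$, and let $\mathrm{var}(A)=\{\bot\}\cup\{p \mid p \text{ is a propositional variable occurring in } A\}$. **Theorem (Craig interpolation).** Every W-logic $\mathsf{WL}$ enjoys Craig interpolation: for all formulas $A,B$ of $\mathcal L$, if $\mathsf{WL}\vdash A\to B$, then there is a formula $C$ of $\mathcal L$ such that $\mathsf{WL}\vdash A\to C$, $\mathsf{WL}\vdash C\to B$, and $\mathrm{var}(C)\subseteq\mathrm{var}(A)\cap\mathrm{var}(B)$. -/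

import Mathlib

namespace WLogics

/-- Formulas of the propositional modal language over countably many variables
`p_0, p_1, p_2, ...`; box and diamond are independent primitives. -/
inductive Formula : Type
  | atom : ℕ → Formula
  | bot : Formula
  | and : Formula → Formula → Formula
  | or : Formula → Formula → Formula
  | imp : Formula → Formula → Formula
  | box : Formula → Formula
  | diam : Formula → Formula

namespace Formula

/-- `⊤ := ⊥ → ⊥`. -/
def top : Formula := imp bot bot

/-- `¬ A := A → ⊥`. -/
def neg (A : Formula) : Formula := imp A bot

/-- The (indices of) propositional variables occurring in a formula. -/
def atoms : Formula → Set ℕ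
  | atom p => {p}
  | bot => ∅
  | and A B => atoms A ∪ atoms B
  | or A B => atoms A ∪ atoms B
  | imp A B => atoms A ∪ atoms B
  | box A => atoms A
  | diam A => atoms A

/-- `var(A) = {⊥} ∪ {p | p a propositional variable occurring in A}`. -/
def var (A : Formula) : Set Formula := {bot} ∪ atom '' A.atoms

end Formula

open Formula in
/-- Axiom schemes of intuitionistic propositional logic (with modus ponens as its rule). -/
inductive IPLAxiom : Formula → Prop
  | k (A B : Formula) : IPLAxiom (imp A (imp B A))
  | s (A B C : Formula) :
      IPLAxiom (imp (imp A (imp B C)) (imp (imp A B) (imp A C)))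
  | andLeft (A B : Formula) : IPLAxiom (imp (and A B) A)
  | andRight (A B : Formula) : IPLAxiom (imp (and A B) B)
  | andIntro (A B : Formula) : IPLAxiom (imp A (imp B (and A B)))
  | orLeft (A B : Formula) : IPLAxiom (imp A (or A B))
  | orRight (A B : Formula) : IPLAxiom (imp B (or A B))
  | orElim (A B C : Formula) :
      IPLAxiom (imp (imp A C) (imp (imp B C) (imp (or A B) C)))
  | exFalso (A : Formula) : IPLAxiom (imp bot A)

/-- Names of the modal axiom schemes used by the W-logics. -/
inductive ModalAxiom : Type
  | dualAnd | Nbox | Cbox | Kdiam | Pdiam | D | Tbox | Tdiam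

open Formula in
/-- `ax.Instance F`: the formula `F` is an instance of the modal axiom scheme `ax`. -/
inductive ModalAxiom.Instance : ModalAxiom → Formula → Prop
  | dualAnd (A : Formula) : Instance dualAnd (neg (and (box A) (diam (neg A))))
  | Nbox : Instance Nbox (box top)
  | Cbox (A B : Formula) :
      Instance Cbox (imp (and (box A) (box B)) (box (and A B)))
  | Kdiam (A B : Formula) :
      Instance Kdiam (imp (box (imp A B)) (imp (diam A) (diam B)))
  | Pdiam : Instance Pdiam (diam top)
  | D (A : Formula) : Instance D (imp (box A) (diam A))
  | Tbox (A : Formula) : Instance Tbox (imp (box A) A)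
  | Tdiam (A : Formula) : Instance Tdiam (imp A (diam A))

/-- The fourteen W-logics. -/
inductive WLogic : Type
  | WM | WMN | WMC | WK
  | WMP | WMNP
  | WMD | WMND | WMCD | WKD
  | WMT | WMNT | WMCT | WKT

namespace WLogic

open ModalAxiom in
/-- The modal axiom schemes of each W-logic. -/
def modalAxioms : WLogic → Set ModalAxiom
  | WM => {dualAnd}
  | WMN => {dualAnd, Nbox}
  | WMC => {dualAnd, Cbox, Kdiam}
  | WK => {dualAnd, Cbox, Kdiam, Nbox}
  | WMP => {dualAnd, Pdiam}
  | WMNP => {dualAnd, Nbox, Pdiam}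
  | WMD => {dualAnd, ModalAxiom.D, Pdiam}
  | WMND => {dualAnd, Nbox, ModalAxiom.D}
  | WMCD => {dualAnd, Cbox, Kdiam, ModalAxiom.D, Pdiam}
  | WKD => {dualAnd, Cbox, Kdiam, Nbox, ModalAxiom.D}
  | WMT => {dualAnd, Tbox, Tdiam}
  | WMNT => {dualAnd, Nbox, Tbox, Tdiam}
  | WMCT => {dualAnd, Cbox, Kdiam, Tbox, Tdiam}
  | WKT => {dualAnd, Cbox, Kdiam, Nbox, Tbox, Tdiam}

open Formula in
/-- `L.Provable A`: the formula `A` is a theorem of the axiom system `L`, i.e. it is obtained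
from axioms of `L` by modus ponens and the two monotonicity rules. -/
inductive Provable (L : WLogic) : Formula → Prop
  | ipl {A : Formula} (h : IPLAxiom A) : Provable L A
  | modal {ax : ModalAxiom} (hax : ax ∈ L.modalAxioms) {A : Formula}
      (h : ax.Instance A) : Provable L A
  | mp {A B : Formula} (h₁ : Provable L (imp A B)) (h₂ : Provable L A) : Provable L B
  | monBox {A B : Formula} (h : Provable L (imp A B)) :
      Provable L (imp (box A) (box B))
  | monDiam {A B : Formula} (h : Provable L (imp A B)) :
      Provable L (imp (diam A) (diam B))

/-- `L` enjoys Craig interpolation. -/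
def EnjoysCraigInterpolation (L : WLogic) : Prop :=
  ∀ A B : Formula, L.Provable (Formula.imp A B) →
    ∃ C : Formula, L.Provable (Formula.imp A C) ∧ L.Provable (Formula.imp C B) ∧
      C.var ⊆ A.var ∩ B.var

end WLogic

end WLogics

/-!
The proof is algebraic: it shows that the Lindenbaum algebra of each W-logic admits
superamalgamation of its fragments.

Let `α` be the Lindenbaum algebra of `L`, let its two sides be the classes of formulas over the
variables of `A` and over those of `B`, and let `C` be the classes of formulas over the common
variables. Call an element `c` of one side *entailed* at a pair `x` of elements, one from each
side, if some `I ∈ C` lies above the component of `x` on the other side and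
`x i ⊓ I ≤ c` for the component on the side of `c`. As `C` is closed under implication, the side
on which an element of `C` is read does not matter (`entailed_common`). The sets of pairs entailing
a given element are lower sets, and the sublocale `H` which they generate in the frame of lower
sets receives both sides as Heyting subalgebras (`spanAmalgam`). By construction, an inequality in
`H` between elements of the two sides is witnessed by an interpolant in `C`.

It remains to extend the box and the diamond of the two sides to `H` so that the axioms of `L`
survive. Without the axioms `Cbox` and `Kdiam`, the least monotone box and the greatest monotone
diamond do this (`Amalgam.monotoneOps_validates`). With them, the box has to be generated by joint
boxes `□a ⊓ □b` of elements of the two sides, and the diamond has to satisfy the bounds that `Kdiam`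
and `dualAnd` impose relative to such joint boxes (`Amalgam.regularOps_validates`). In each case the
interpolants given by `H` for the arguments of the modalities provide the interpolants needed for
the modalised elements, and the axioms of `L` transfer one at a time.

If `L` proves `A → B`, soundness in `H` gives that the value of `A` is below that of `B`. These
values are the images of the classes of `A` and `B` from the two sides (`WLogic.value_eq_e`), so an
interpolant exists.
-/

namespace WLogics

/-! ### Amalgamating two Heyting subalgebras -/

/-- `s` is the carrier of a Heyting subalgebra. -/
structure IsHeytingSub {α : Type*} [HeytingAlgebra α] (s : Set α) : Prop where
  bot_mem : ⊥ ∈ s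
  inf_mem {a b : α} : a ∈ s → b ∈ s → a ⊓ b ∈ s
  sup_mem {a b : α} : a ∈ s → b ∈ s → a ⊔ b ∈ s
  himp_mem {a b : α} : a ∈ s → b ∈ s → a ⇨ b ∈ s

lemma IsHeytingSub.top_mem {α : Type*} [HeytingAlgebra α] {s : Set α} (h : IsHeytingSub s) :
    ⊤ ∈ s := by
  simpa using h.himp_mem h.bot_mem h.bot_mem

/-- Two Heyting subalgebras `S true`, `S false` of `α` together with a Heyting subalgebra `C` of
both, which need not be their whole intersection. -/
structure IsSpan {α : Type*} [HeytingAlgebra α] (S : Bool → Set α) (C : Set α) : Prop where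
  side (i : Bool) : IsHeytingSub (S i)
  common : IsHeytingSub C
  subset (i : Bool) : C ⊆ S i

/-- A frame `H` into which the two sides of a span embed as Heyting algebras, with the same
restriction to `C`, and so that an inequality in `H` between elements of the two sides is always
witnessed by an interpolant in `C`. -/
structure Amalgam {α : Type*} [HeytingAlgebra α] (S : Bool → Set α) (C : Set α)
    (H : Type*) [Order.Frame H] where
  /-- The embedding of side `i`; only its values on `S i` matter. -/
  e : Bool → α → H
  e_bot (i : Bool) : e i ⊥ = ⊥
  e_inf (i : Bool) {a b : α} : a ∈ S i → b ∈ S i → e i (a ⊓ b) = e i a ⊓ e i b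
  e_sup (i : Bool) {a b : α} : a ∈ S i → b ∈ S i → e i (a ⊔ b) = e i a ⊔ e i b
  e_himp (i : Bool) {a b : α} : a ∈ S i → b ∈ S i → e i (a ⇨ b) = e i a ⇨ e i b
  e_common (i j : Bool) {c : α} : c ∈ C → e i c = e j c
  interpolant (w : ∀ i, S i) (j : Bool) {c : α} : c ∈ S j → ⨅ i, e i (w i) ≤ e j c →
    ∃ I ∈ C, (w (!j) : α) ≤ I ∧ (w j : α) ⊓ I ≤ c

/-- The sublocale of a frame generated by a family `β`: it consists of the `u` that equal the meet
of the elements `(u ⇨ β k) ⇨ β k`. -/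
def generatedSublocale {X κ : Type*} [Order.Frame X] (β : κ → X) : Sublocale X where
  carrier := {u | ⨅ k, (u ⇨ β k) ⇨ β k ≤ u}
  sInf_mem' s hs := by
    refine le_sInf fun b hb => le_trans ?_ (hs hb)
    exact iInf_mono fun k => himp_le_himp_right (himp_le_himp_right (sInf_le hb))
  himp_mem' a b hb := by
    rw [Set.mem_ofPred_eq, le_himp_iff]
    refine le_trans (le_iInf fun k => ?_) hb
    refine le_trans (inf_le_inf_right _ (iInf_le _ k)) ?_
    rw [le_himp_iff, inf_assoc]
    suffices h : a ⊓ (b ⇨ β k) ≤ (a ⇨ b) ⇨ β k from (inf_le_inf_left _ h).trans himp_inf_le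
    rw [le_himp_iff]
    calc a ⊓ (b ⇨ β k) ⊓ (a ⇨ b) = (b ⇨ β k) ⊓ ((a ⇨ b) ⊓ a) := by ac_rfl
      _ ≤ (b ⇨ β k) ⊓ b := inf_le_inf_left _ himp_inf_le
      _ ≤ β k := himp_inf_le

section Construction

lemma coe_not_not {α : Type*} {S : Bool → Set α} (x : ∀ i, S i) (i : Bool) : (x (!!i) : α) = x i := by
  cases i <;> rfl

variable {α : Type*} [HeytingAlgebra α] {S : Bool → Set α} {C : Set α}

/-- The points `x` at which the element `c`, regarded as belonging to side `i`, follows from the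
pair `(x true, x false)` through an interpolant in `C`. -/
def entailed (S : Bool → Set α) (C : Set α) (k : Bool × α) : LowerSet (∀ i, S i) where
  carrier := {x | ∃ I ∈ C, (x (!k.1) : α) ≤ I ∧ (x k.1 : α) ⊓ I ≤ k.2}
  lower' := by
    rintro x y hyx ⟨I, hI, h₁, h₂⟩
    have h (i) : (y i : α) ≤ x i := hyx i
    exact ⟨I, hI, (h _).trans h₁, (inf_le_inf_right _ (h _)).trans h₂⟩

lemma mem_entailed {x : ∀ i, S i} {i : Bool} {c : α} :
    x ∈ entailed S C (i, c) ↔ ∃ I ∈ C, (x (!i) : α) ≤ I ∧ (x i : α) ⊓ I ≤ c := Iff.rfl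

/-- An element of `C` is entailed in the same way on either side: an interpolant `I` for one side
turns into `I ⇨ c` for the other. -/
lemma entailed_common (hS : IsSpan S C) (i j : Bool) {c : α} (hc : c ∈ C) :
    entailed S C (i, c) = entailed S C (j, c) := by
  have key (i : Bool) : entailed S C (i, c) ≤ entailed S C (!i, c) := by
    rintro x ⟨I, hI, h₁, h₂⟩
    refine ⟨I ⇨ c, hS.common.himp_mem hI hc, ?_, ?_⟩
    · simpa [coe_not_not] using h₂
    · exact (inf_le_inf_right _ h₁).trans inf_himp_le
  have key' (i : Bool) : entailed S C (i, c) = entailed S C (!i, c) :=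
    le_antisymm (key i) (by simpa using key (!i))
  cases i <;> cases j <;> first | rfl | exact key' _

/-- The point `x` with `a` added to its component on side `i`. -/
def strengthen (hS : IsSpan S C) (x : ∀ i, S i) (i : Bool) {a : α} (ha : a ∈ S i) : ∀ i, S i :=
  Function.update x i ⟨(x i : α) ⊓ a, (hS.side i).inf_mem (x i).2 ha⟩

section
variable (hS : IsSpan S C) (x : ∀ i, S i) {i : Bool} {a : α} (ha : a ∈ S i)
include hS

@[simp] lemma strengthen_same : (strengthen hS x i ha i : α) = (x i : α) ⊓ a := by simp [strengthen]

@[simp] lemma strengthen_not : strengthen hS x i ha (!i) = x (!i) := by simp [strengthen]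

lemma strengthen_le : strengthen hS x i ha ≤ x := by
  rw [strengthen, update_le_self_iff, ← Subtype.coe_le_coe]
  exact inf_le_left

lemma strengthen_mem : strengthen hS x i ha ∈ entailed S C (i, a) :=
  mem_entailed.2 ⟨⊤, hS.common.top_mem, le_top, by simp⟩

end

lemma entailed_bot_le (hS : IsSpan S C) (i : Bool) (k : Bool × α) :
    entailed S C (i, ⊥) ≤ entailed S C k := by
  have key (j : Bool) (c : α) : entailed S C (j, ⊥) ≤ entailed S C (j, c) := by
    rintro x ⟨I, hI, h₁, h₂⟩
    exact ⟨I, hI, h₁, h₂.trans bot_le⟩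
  rw [entailed_common hS i k.1 hS.common.bot_mem]
  exact key _ _

lemma entailed_inf (hS : IsSpan S C) (i : Bool) (a b : α) :
    entailed S C (i, a ⊓ b) = entailed S C (i, a) ⊓ entailed S C (i, b) := by
  apply le_antisymm
  · rintro x ⟨I, hI, h₁, h₂⟩
    exact ⟨⟨I, hI, h₁, h₂.trans inf_le_left⟩, ⟨I, hI, h₁, h₂.trans inf_le_right⟩⟩
  · rintro x ⟨⟨I, hI, h₁, h₂⟩, ⟨J, hJ, h₃, h₄⟩⟩
    refine ⟨I ⊓ J, hS.common.inf_mem hI hJ, le_inf h₁ h₃, le_inf ?_ ?_⟩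
    · exact (inf_le_inf_left _ inf_le_left).trans h₂
    · exact (inf_le_inf_left _ inf_le_right).trans h₄

lemma entailed_himp (hS : IsSpan S C) (i : Bool) {a : α} (ha : a ∈ S i) (b : α) :
    entailed S C (i, a ⇨ b) = entailed S C (i, a) ⇨ entailed S C (i, b) := by
  apply le_antisymm
  · rw [le_himp_iff, ← entailed_inf hS]
    rintro x ⟨I, hI, h₁, h₂⟩
    exact ⟨I, hI, h₁, h₂.trans (himp_inf_le)⟩
  · intro x hx
    have hy : strengthen hS x i ha ∈ entailed S C (i, b) := by
      have : (entailed S C (i, a) ⇨ entailed S C (i, b)) ⊓ entailed S C (i, a)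
          ≤ entailed S C (i, b) := himp_inf_le
      exact this ⟨LowerSet.lower _ (strengthen_le hS x ha) hx, strengthen_mem hS x ha⟩
    obtain ⟨I, hI, h₁, h₂⟩ := mem_entailed.1 hy
    refine ⟨I, hI, by simpa using h₁, ?_⟩
    rw [le_himp_iff]
    simpa [inf_right_comm] using h₂

/-- Elimination of a join entailed at a point, for an arbitrary conclusion `k`. If `k` lies on the
other side than the join, the interpolant is `J ⇨ I ⊔ K`, with `J` an interpolant for the join and
`I`, `K` interpolants for the two cases. -/
lemma entailed_sup_elim (hS : IsSpan S C) (i : Bool) {a b : α} (ha : a ∈ S i) (hb : b ∈ S i)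
    (k : Bool × α) :
    entailed S C (i, a ⊔ b) ⊓ (entailed S C (i, a) ⇨ entailed S C k) ⊓
      (entailed S C (i, b) ⇨ entailed S C k) ≤ entailed S C k := by
  obtain ⟨j, c⟩ := k
  rintro x ⟨⟨hx, hxa⟩, hxb⟩
  have step {d : α} (hd : d ∈ S i) (hxd : x ∈ entailed S C (i, d) ⇨ entailed S C (j, c)) :
      strengthen hS x i hd ∈ entailed S C (j, c) := by
    have : (entailed S C (i, d) ⇨ entailed S C (j, c)) ⊓ entailed S C (i, d)
        ≤ entailed S C (j, c) := himp_inf_le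
    exact this ⟨LowerSet.lower _ (strengthen_le hS x hd) hxd, strengthen_mem hS x hd⟩
  obtain ⟨J, hJ, h₁, h₂⟩ := mem_entailed.1 hx
  obtain ⟨I, hI, h₃, h₄⟩ := mem_entailed.1 (step ha hxa)
  obtain ⟨K, hK, h₅, h₆⟩ := mem_entailed.1 (step hb hxb)
  change ∃ I ∈ C, (x (!j) : α) ≤ I ∧ (x j : α) ⊓ I ≤ c
  obtain rfl | rfl : j = i ∨ j = !i := by cases i <;> cases j <;> simp
  · simp only [strengthen_not, strengthen_same] at h₃ h₄ h₅ h₆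
    refine ⟨J ⊓ (I ⊓ K), hS.common.inf_mem hJ (hS.common.inf_mem hI hK),
      le_inf h₁ (le_inf h₃ h₅), ?_⟩
    calc (x j : α) ⊓ (J ⊓ (I ⊓ K)) ≤ ((x j : α) ⊓ (I ⊓ K)) ⊓ (a ⊔ b) :=
          le_inf (inf_le_inf_left _ inf_le_right)
            ((inf_le_inf_left _ inf_le_left).trans h₂)
      _ ≤ c := by
        rw [inf_sup_left]
        refine sup_le (le_trans ?_ h₄) (le_trans ?_ h₆)
        · exact le_inf (inf_le_inf_right _ inf_le_left)
            (inf_le_left.trans (inf_le_right.trans inf_le_left))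
        · exact le_inf (inf_le_inf_right _ inf_le_left)
            (inf_le_left.trans (inf_le_right.trans inf_le_right))
  · simp only [coe_not_not, strengthen_not, strengthen_same] at h₃ h₄ h₅ h₆
    refine ⟨J ⇨ I ⊔ K, hS.common.himp_mem hJ (hS.common.sup_mem hI hK), ?_, ?_⟩
    · rw [le_himp_iff, coe_not_not]
      calc (x i : α) ⊓ J ≤ (x i : α) ⊓ (a ⊔ b) := le_inf inf_le_left h₂
        _ ≤ I ⊔ K := by rw [inf_sup_left]; exact sup_le_sup h₃ h₅
    · calc (x (!i) : α) ⊓ (J ⇨ I ⊔ K) ≤ (x (!i) : α) ⊓ (I ⊔ K) :=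
            le_inf inf_le_left ((inf_le_inf_right _ h₁).trans inf_himp_le)
        _ ≤ c := by rw [inf_sup_left]; exact sup_le h₄ h₆

lemma entailed_mem (S : Bool → Set α) (C : Set α) (k : Bool × α) :
    entailed S C k ∈ generatedSublocale (entailed S C) := by
  change ⨅ l, (entailed S C k ⇨ entailed S C l) ⇨ entailed S C l ≤ entailed S C k
  exact (iInf_le _ k).trans (by simp)

/-- Every span of Heyting algebras has an amalgam: the sublocale generated by the lower sets
`entailed S C k`. -/
def spanAmalgam (hS : IsSpan S C) : Amalgam S C (generatedSublocale (entailed S C)) where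
  e i a := ⟨entailed S C (i, a), entailed_mem S C _⟩
  e_bot i := by
    refine eq_bot_iff.2 ?_
    rw [← Subtype.coe_le_coe]
    refine le_trans (le_iInf fun k => ?_) (⊥ : generatedSublocale (entailed S C)).2
    exact (entailed_bot_le hS i k).trans le_himp
  e_inf i a b _ _ := Subtype.ext (entailed_inf hS i a b)
  e_sup i a b ha hb := by
    apply le_antisymm
    · rw [← Subtype.coe_le_coe]
      set z : generatedSublocale (entailed S C) :=
        ⟨entailed S C (i, a), entailed_mem S C _⟩ ⊔ ⟨entailed S C (i, b), entailed_mem S C _⟩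
        with hz
      have hza : entailed S C (i, a) ≤ z := Subtype.coe_le_coe.2 (hz ▸ le_sup_left)
      have hzb : entailed S C (i, b) ≤ z := Subtype.coe_le_coe.2 (hz ▸ le_sup_right)
      refine le_trans (le_iInf fun k => ?_) z.2
      rw [le_himp_iff]
      refine le_trans ?_ (entailed_sup_elim hS i ha hb k)
      exact le_inf (inf_le_inf_left _ (himp_le_himp_right hza))
        (inf_le_right.trans (himp_le_himp_right hzb))
    · have (d : α) (hd : d ≤ a ⊔ b) : entailed S C (i, d) ≤ entailed S C (i, a ⊔ b) := by
        rintro x ⟨I, hI, h₁, h₂⟩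
        exact ⟨I, hI, h₁, h₂.trans hd⟩
      exact sup_le (Subtype.coe_le_coe.1 (this a le_sup_left))
        (Subtype.coe_le_coe.1 (this b le_sup_right))
  e_himp i a b ha _ := Subtype.ext (entailed_himp hS i ha b)
  e_common i j c hc := Subtype.ext (entailed_common hS i j hc)
  interpolant w j c _ h := by
    rw [← Subtype.coe_le_coe, Sublocale.coe_iInf] at h
    refine mem_entailed.1 (h ?_)
    refine LowerSet.mem_iInf_iff.2 ?_
    exact fun i => mem_entailed.2 ⟨⊤, hS.common.top_mem, le_top, inf_le_left⟩

end Construction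

/-! ### Modal operators on Heyting algebras -/

/-- A monotone box and a monotone diamond on a Heyting algebra. -/
structure ModalOps (α : Type*) [HeytingAlgebra α] where
  /-- The box. -/
  box : α →o α
  /-- The diamond. -/
  dia : α →o α

namespace ModalOps

/-- Validity of the modal axiom schemes in a Heyting algebra with modal operators. -/
def Validates {α : Type*} [HeytingAlgebra α] (M : ModalOps α) : ModalAxiom → Prop
  | .dualAnd => ∀ a, M.box a ⊓ M.dia (a ⇨ ⊥) ≤ ⊥
  | .Nbox => ⊤ ≤ M.box ⊤
  | .Cbox => ∀ a b, M.box a ⊓ M.box b ≤ M.box (a ⊓ b)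
  | .Kdiam => ∀ a b, M.box (a ⇨ b) ≤ M.dia a ⇨ M.dia b
  | .Pdiam => ⊤ ≤ M.dia ⊤
  | .D => ∀ a, M.box a ≤ M.dia a
  | .Tbox => ∀ a, M.box a ≤ a
  | .Tdiam => ∀ a, a ≤ M.dia a

section
variable {α : Type*} [HeytingAlgebra α] {M : ModalOps α}

lemma box_inf_box_le (hC : M.Validates .Cbox) {a b c : α} (h : a ⊓ b ≤ c) :
    M.box a ⊓ M.box b ≤ M.box c :=
  (hC a b).trans (M.box.monotone h)

lemma box_inf_dia_le (hK : M.Validates .Kdiam) {a d c : α} (h : a ⊓ d ≤ c) :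
    M.box a ⊓ M.dia d ≤ M.dia c :=
  le_himp_iff.1 ((M.box.monotone (le_himp_iff.2 h)).trans (hK d c))

lemma box_inf_dia_le_bot (hd : M.Validates .dualAnd) {a d : α} (h : a ⊓ d ≤ ⊥) :
    M.box a ⊓ M.dia d ≤ ⊥ :=
  (inf_le_inf_left _ (M.dia.monotone (le_himp_iff.2 (by rwa [inf_comm])))).trans (hd a)

/-- Either of `Pdiam` and `D` refutes `□⊥`: `dualAnd` makes it incompatible with `◇⊤`, and `□⊤` with
`◇⊥`. -/
lemma box_bot_le (hd : M.Validates .dualAnd) (h : M.Validates .Pdiam ∨ M.Validates .D) :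
    M.box ⊥ ≤ ⊥ := by
  rcases h with hP | hD
  · calc M.box ⊥ ≤ M.box ⊥ ⊓ M.dia ⊤ := le_inf le_rfl (le_top.trans hP)
      _ ≤ ⊥ := box_inf_dia_le_bot hd (by simp)
  · calc M.box ⊥ ≤ M.box ⊤ ⊓ M.dia ⊥ := le_inf (M.box.monotone bot_le) (hD ⊥)
      _ ≤ ⊥ := box_inf_dia_le_bot hd (by simp)

end

end ModalOps

/-- The sides and the common part of the span are closed under the modal operators. -/
structure ModalOps.Preserves {α : Type*} [HeytingAlgebra α] (M : ModalOps α) (S : Bool → Set α)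
    (C : Set α) : Prop where
  box_mem (i : Bool) {a : α} : a ∈ S i → M.box a ∈ S i
  dia_mem (i : Bool) {a : α} : a ∈ S i → M.dia a ∈ S i
  box_mem_common {a : α} : a ∈ C → M.box a ∈ C
  dia_mem_common {a : α} : a ∈ C → M.dia a ∈ C

namespace Amalgam

variable {α : Type*} [HeytingAlgebra α] {S : Bool → Set α} {C : Set α}
  {H : Type*} [Order.Frame H]

lemma e_mono (E : Amalgam S C H) (i : Bool) {a b : α} (ha : a ∈ S i) (hb : b ∈ S i) (h : a ≤ b) :
    E.e i a ≤ E.e i b := by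
  rw [← inf_eq_left.2 h, E.e_inf i ha hb]
  exact inf_le_right

lemma e_top (E : Amalgam S C H) (hS : IsSpan S C) (i : Bool) : E.e i ⊤ = ⊤ := by
  have h := E.e_himp i (hS.side i).bot_mem (hS.side i).bot_mem
  simpa using h

/-- The modal operators `N` on `H` extend those of `M` on the two sides. -/
def Extends (E : Amalgam S C H) (M : ModalOps α) (N : ModalOps H) : Prop :=
  ∀ i, ∀ a ∈ S i, N.box (E.e i a) = E.e i (M.box a) ∧ N.dia (E.e i a) = E.e i (M.dia a)

/-! ### The modal operators on the amalgam, without `Cbox` and `Kdiam` -/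

section Monotone

/-- The point that is `a` on side `i` and `⊤` on the other side. -/
def single (hS : IsSpan S C) (i : Bool) {a : α} (ha : a ∈ S i) : ∀ j, S j :=
  Function.update (fun j => ⟨⊤, (hS.side j).top_mem⟩) i ⟨a, ha⟩

lemma iInf_single_le (E : Amalgam S C H) (hS : IsSpan S C) (i : Bool) {a : α} (ha : a ∈ S i) :
    ⨅ j, E.e j (single hS i ha j) ≤ E.e i a :=
  (iInf_le _ i).trans (by simp [single])

lemma le_iInf_single (E : Amalgam S C H) (hS : IsSpan S C) (i : Bool) {a : α} (ha : a ∈ S i) :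
    E.e i a ≤ ⨅ j, E.e j (single hS i ha j) := by
  refine le_iInf fun j => ?_
  obtain rfl | h := eq_or_ne j i
  · simp [single]
  · simp [single, h, E.e_top hS]

/-- If `a` and `b` lie on different sides, an interpolant carries `a ≤ b` to `f a ≤ g b`. -/
lemma map_le_map (E : Amalgam S C H) (hS : IsSpan S C) {f g : α → α} (hf : Monotone f)
    (hfg : ∀ a, f a ≤ g a) (hg : Monotone g)
    (hfS : ∀ i, ∀ a ∈ S i, f a ∈ S i) (hgS : ∀ i, ∀ a ∈ S i, g a ∈ S i) (hfC : ∀ a ∈ C, f a ∈ C)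
    {i j : Bool} {a b : α} (ha : a ∈ S i) (hb : b ∈ S j) (h : E.e i a ≤ E.e j b) :
    E.e i (f a) ≤ E.e j (g b) := by
  obtain ⟨I, hI, h₁, h₂⟩ := E.interpolant (single hS i ha) j hb ((E.iInf_single_le hS i ha).trans h)
  obtain rfl | rfl : j = i ∨ j = !i := by cases i <;> cases j <;> simp
  · have h₁' : I = ⊤ := by
      refine top_le_iff.1 (le_trans (le_of_eq ?_) h₁)
      simp [single]
    have h₂' : a ≤ b := by simpa [single, h₁'] using h₂
    exact E.e_mono j (hfS j a ha) (hgS j b hb) ((hf h₂').trans (hfg b))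
  · have h₁' : a ≤ I := by simpa [coe_not_not, single] using h₁
    have h₂' : I ≤ b := by simpa [single] using h₂
    calc E.e i (f a) ≤ E.e i (f I) :=
          E.e_mono i (hfS i a ha) (hfS i I (hS.subset i hI)) (hf h₁')
      _ = E.e (!i) (f I) := E.e_common i (!i) (hfC I hI)
      _ ≤ E.e (!i) (g b) :=
          E.e_mono (!i) (hfS _ I (hS.subset _ hI)) (hgS _ b hb) ((hfg I).trans (hg h₂'))

/-- The least monotone box and the greatest monotone diamond on `H` extending those on both
sides. -/
def monotoneOps (E : Amalgam S C H) (M : ModalOps α) : ModalOps H where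
  box :=
    { toFun X := ⨆ (i : Bool) (a : α) (_ : a ∈ S i ∧ E.e i a ≤ X), E.e i (M.box a)
      monotone' _ _ h := iSup_mono fun _ => iSup_mono fun _ =>
        iSup_mono' fun h' => ⟨⟨h'.1, h'.2.trans h⟩, le_rfl⟩ }
  dia :=
    { toFun X := ⨅ (i : Bool) (a : α) (_ : a ∈ S i ∧ X ≤ E.e i a), E.e i (M.dia a)
      monotone' _ _ h := iInf_mono fun _ => iInf_mono fun _ =>
        iInf_mono' fun h' => ⟨⟨h'.1, h.trans h'.2⟩, le_rfl⟩ }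

variable (E : Amalgam S C H) {M : ModalOps α}

lemma monotoneOps_box_le {X Y : H} :
    (E.monotoneOps M).box X ≤ Y ↔
      ∀ i, ∀ a ∈ S i, E.e i a ≤ X → E.e i (M.box a) ≤ Y := by
  change (⨆ (i : Bool) (a : α) (_ : a ∈ S i ∧ E.e i a ≤ X), E.e i (M.box a)) ≤ Y ↔ _
  simp only [iSup_le_iff, and_imp]

lemma le_monotoneOps_dia {X Y : H} :
    Y ≤ (E.monotoneOps M).dia X ↔
      ∀ i, ∀ a ∈ S i, X ≤ E.e i a → Y ≤ E.e i (M.dia a) := by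
  change Y ≤ (⨅ (i : Bool) (a : α) (_ : a ∈ S i ∧ X ≤ E.e i a), E.e i (M.dia a)) ↔ _
  simp only [le_iInf_iff, and_imp]

lemma e_box_le_monotoneOps {X : H} {i : Bool} {a : α} (ha : a ∈ S i) (h : E.e i a ≤ X) :
    E.e i (M.box a) ≤ (E.monotoneOps M).box X :=
  (E.monotoneOps_box_le).1 le_rfl i a ha h

lemma monotoneOps_dia_le_e {X : H} {i : Bool} {a : α} (ha : a ∈ S i) (h : X ≤ E.e i a) :
    (E.monotoneOps M).dia X ≤ E.e i (M.dia a) :=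
  (E.le_monotoneOps_dia).1 le_rfl i a ha h

lemma monotoneOps_extends (hS : IsSpan S C) (hM : M.Preserves S C) :
    E.Extends M (E.monotoneOps M) := by
  refine fun i a ha => ⟨le_antisymm ?_ (E.e_box_le_monotoneOps ha le_rfl),
    le_antisymm (E.monotoneOps_dia_le_e ha le_rfl) ?_⟩
  · refine E.monotoneOps_box_le.2 fun j b hb h => ?_
    exact E.map_le_map hS M.box.monotone (fun _ => le_rfl) M.box.monotone
      (fun i _ => hM.box_mem i) (fun i _ => hM.box_mem i) (fun _ => hM.box_mem_common) hb ha h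
  · refine E.le_monotoneOps_dia.2 fun j b hb h => ?_
    exact E.map_le_map hS M.dia.monotone (fun _ => le_rfl) M.dia.monotone
      (fun i _ => hM.dia_mem i) (fun i _ => hM.dia_mem i) (fun _ => hM.dia_mem_common) ha hb h

/-- Apart from `Cbox` and `Kdiam`, each modal axiom passes from the two sides to their amalgam. -/
lemma monotoneOps_validates (hS : IsSpan S C) (hM : M.Preserves S C) {ax : ModalAxiom}
    (hC : ax ≠ .Cbox) (hK : ax ≠ .Kdiam) (hax : M.Validates ax) :
    (E.monotoneOps M).Validates ax := by
  cases ax with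
  | dualAnd =>
    intro X
    rw [← le_himp_iff, E.monotoneOps_box_le]
    intro i a ha h
    have hbot := (hS.side i).bot_mem
    have hneg := (hS.side i).himp_mem ha hbot
    rw [le_himp_iff]
    calc E.e i (M.box a) ⊓ (E.monotoneOps M).dia (X ⇨ ⊥)
        ≤ E.e i (M.box a) ⊓ E.e i (M.dia (a ⇨ ⊥)) := by
          refine inf_le_inf_left _ (E.monotoneOps_dia_le_e hneg ?_)
          rw [E.e_himp i ha hbot, E.e_bot]
          exact himp_le_himp_right h
      _ = E.e i (M.box a ⊓ M.dia (a ⇨ ⊥)) :=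
          (E.e_inf i (hM.box_mem i ha) (hM.dia_mem i hneg)).symm
      _ = ⊥ := by rw [le_bot_iff.1 (hax a), E.e_bot]
  | Nbox =>
    change ⊤ ≤ M.box ⊤ at hax
    have h := E.e_box_le_monotoneOps (M := M) (hS.side true).top_mem (le_top (a := E.e true ⊤))
    rwa [top_le_iff.1 hax, E.e_top hS] at h
  | Pdiam =>
    change ⊤ ≤ M.dia ⊤ at hax
    refine E.le_monotoneOps_dia.2 fun i a ha h => ?_
    have h' := E.map_le_map hS M.dia.monotone (fun _ => le_rfl) M.dia.monotone
      (fun i _ => hM.dia_mem i) (fun i _ => hM.dia_mem i) (fun _ => hM.dia_mem_common)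
      (hS.side i).top_mem ha (le_top.trans h)
    rwa [top_le_iff.1 hax, E.e_top hS] at h'
  | D =>
    intro X
    refine E.monotoneOps_box_le.2 fun i a ha h => E.le_monotoneOps_dia.2 fun j b hb h' => ?_
    exact E.map_le_map hS M.box.monotone hax M.dia.monotone
      (fun i _ => hM.box_mem i) (fun i _ => hM.dia_mem i) (fun _ => hM.box_mem_common) ha hb
      (h.trans h')
  | Tbox =>
    intro X
    exact E.monotoneOps_box_le.2 fun i a ha h => (E.e_mono i (hM.box_mem i ha) ha (hax a)).trans h
  | Tdiam =>
    intro X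
    exact E.le_monotoneOps_dia.2 fun i a ha h =>
      h.trans (E.e_mono i ha (hM.dia_mem i ha) (hax a))
  | Cbox => exact absurd rfl hC
  | Kdiam => exact absurd rfl hK

end Monotone

/-! ### The modal operators on the amalgam, with `Cbox` and `Kdiam` -/

section Regular

variable (E : Amalgam S C H) (M : ModalOps α)

/-- The element of `H` at which both components of `w` hold. -/
def meet (w : ∀ i, S i) : H := ⨅ i, E.e i (w i)

/-- The element of `H` at which both components of `w` are necessary. -/
def boxMeet (w : ∀ i, S i) : H := ⨅ i, E.e i (M.box (w i))

/-- The componentwise meet of two points. -/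
def pointInf (hS : IsSpan S C) (w w' : ∀ i, S i) : ∀ i, S i :=
  fun i => ⟨(w i : α) ⊓ w' i, (hS.side i).inf_mem (w i).2 (w' i).2⟩

lemma meet_le (w : ∀ i, S i) (i : Bool) : E.meet w ≤ E.e i (w i) := iInf_le _ i

lemma boxMeet_le (w : ∀ i, S i) (i : Bool) : E.boxMeet M w ≤ E.e i (M.box (w i)) := iInf_le _ i

lemma meet_pointInf (hS : IsSpan S C) (w w' : ∀ i, S i) :
    E.meet (pointInf hS w w') = E.meet w ⊓ E.meet w' := by
  simp only [meet, pointInf, ← iInf_inf_eq]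
  exact iInf_congr fun i => E.e_inf i (w i).2 (w' i).2

lemma boxMeet_inf_le (hS : IsSpan S C) (hM : M.Preserves S C) (hC : M.Validates .Cbox)
    (w w' : ∀ i, S i) :
    E.boxMeet M w ⊓ E.boxMeet M w' ≤ E.boxMeet M (pointInf hS w w') := by
  refine le_iInf fun i => (inf_le_inf (E.boxMeet_le M w i) (E.boxMeet_le M w' i)).trans ?_
  have h := hM.box_mem i (w i).2
  have h' := hM.box_mem i (w' i).2
  rw [← E.e_inf i h h']
  exact E.e_mono i ((hS.side i).inf_mem h h') (hM.box_mem i (pointInf hS w w' i).2) (hC _ _)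

lemma meet_strengthen_le (hS : IsSpan S C) (w : ∀ i, S i) (i : Bool) {a : α} (ha : a ∈ S i) :
    E.meet (strengthen hS w i ha) ≤ E.meet w ⊓ E.e i a := by
  have h := E.meet_le (strengthen hS w i ha) i
  rw [strengthen_same, E.e_inf i (w i).2 ha] at h
  refine le_inf (le_iInf fun j => ?_) (h.trans inf_le_right)
  obtain rfl | rfl : j = i ∨ j = !i := by cases i <;> cases j <;> simp
  · exact h.trans inf_le_left
  · simpa using E.meet_le (strengthen hS w i ha) (!i)

section
variable {M}
/-- An inequality between an element of side `!j` and an element of `C` holds in `H` with the latter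
read on side `j`. -/
lemma e_le_common (hS : IsSpan S C) {j : Bool} {a I : α} (ha : a ∈ S (!j)) (hI : I ∈ C)
    (h : a ≤ I) :
    E.e (!j) a ≤ E.e j I :=
  (E.e_mono (!j) ha (hS.subset _ hI) h).trans_eq (E.e_common _ _ hI)

variable (hS : IsSpan S C) (hM : M.Preserves S C)
include hS hM

lemma boxMeet_le_box (hC : M.Validates .Cbox) {w : ∀ i, S i} {j : Bool} {c : α} (hc : c ∈ S j)
    (h : E.meet w ≤ E.e j c) : E.boxMeet M w ≤ E.e j (M.box c) := by
  obtain ⟨I, hI, h₁, h₂⟩ := E.interpolant w j hc h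
  have hw := hM.box_mem j (w j).2
  have hbI := hM.box_mem_common hI
  calc E.boxMeet M w ≤ E.e j (M.box (w j)) ⊓ E.e j (M.box I) :=
        le_inf (E.boxMeet_le M w j) ((E.boxMeet_le M w (!j)).trans
          (E.e_le_common hS (hM.box_mem _ (w (!j)).2) hbI (M.box.monotone h₁)))
    _ = E.e j (M.box (w j) ⊓ M.box I) := (E.e_inf j hw (hS.subset j hbI)).symm
    _ ≤ E.e j (M.box c) := E.e_mono j ((hS.side j).inf_mem hw (hS.subset j hbI))
        (hM.box_mem j hc) (ModalOps.box_inf_box_le hC h₂)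

lemma boxMeet_inf_dia_le (hC : M.Validates .Cbox) (hK : M.Validates .Kdiam) {w : ∀ i, S i}
    {i j : Bool} {c d : α} (hd : d ∈ S i) (hc : c ∈ S j) (h : E.meet w ⊓ E.e i d ≤ E.e j c) :
    E.boxMeet M w ⊓ E.e i (M.dia d) ≤ E.e j (M.dia c) := by
  obtain ⟨I, hI, h₁, h₂⟩ := E.interpolant (strengthen hS w i hd) j hc
    ((E.meet_strengthen_le hS w i hd).trans h)
  obtain rfl | rfl : j = i ∨ j = !i := by cases i <;> cases j <;> simp
  · rw [strengthen_not] at h₁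
    rw [strengthen_same, inf_right_comm] at h₂
    have hwI := (hS.side j).inf_mem (w j).2 (hS.subset j hI)
    have hbox : E.boxMeet M w ≤ E.e j (M.box ((w j : α) ⊓ I)) := by
      refine E.boxMeet_le_box hS hM hC hwI ?_
      rw [E.e_inf j (w j).2 (hS.subset j hI)]
      exact le_inf (E.meet_le w j)
        ((E.meet_le w (!j)).trans (E.e_le_common hS (w (!j)).2 hI h₁))
    have h₃ := hM.box_mem j hwI
    have h₄ := hM.dia_mem j hd
    refine (inf_le_inf_right _ hbox).trans ?_
    rw [← E.e_inf j h₃ h₄]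
    exact E.e_mono j ((hS.side j).inf_mem h₃ h₄) (hM.dia_mem j hc) (ModalOps.box_inf_dia_le hK h₂)
  · rw [coe_not_not, strengthen_same] at h₁
    rw [strengthen_not] at h₂
    have hdI := hM.dia_mem_common hI
    have hw := hM.box_mem i (w i).2
    have hw' := hM.box_mem (!i) (w (!i)).2
    have hdd := hM.dia_mem i hd
    calc E.boxMeet M w ⊓ E.e i (M.dia d)
        ≤ E.e (!i) (M.box (w (!i))) ⊓ (E.e i (M.box (w i)) ⊓ E.e i (M.dia d)) :=
          le_inf (inf_le_left.trans (E.boxMeet_le M w (!i)))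
            (inf_le_inf_right _ (E.boxMeet_le M w i))
      _ ≤ E.e (!i) (M.box (w (!i))) ⊓ E.e (!i) (M.dia I) := by
          refine inf_le_inf_left _ ?_
          rw [← E.e_inf i hw hdd, ← E.e_common i (!i) hdI]
          exact E.e_mono i ((hS.side i).inf_mem hw hdd) (hS.subset i hdI)
            (ModalOps.box_inf_dia_le hK h₁)
      _ ≤ E.e (!i) (M.dia c) := by
          rw [← E.e_inf (!i) hw' (hS.subset _ hdI)]
          exact E.e_mono (!i) ((hS.side _).inf_mem hw' (hS.subset _ hdI)) (hM.dia_mem _ hc)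
            (ModalOps.box_inf_dia_le hK h₂)

lemma boxMeet_inf_dia_le_bot (hC : M.Validates .Cbox) (hd : M.Validates .dualAnd)
    {w : ∀ i, S i} {i : Bool} {d : α} (hdS : d ∈ S i) (h : E.meet w ⊓ E.e i d ≤ ⊥) :
    E.boxMeet M w ⊓ E.e i (M.dia d) ≤ ⊥ := by
  have hbot := (hS.side i).bot_mem
  have hneg := (hS.side i).himp_mem hdS hbot
  have hbox : E.boxMeet M w ≤ E.e i (M.box (d ⇨ ⊥)) := by
    refine E.boxMeet_le_box hS hM hC hneg ?_
    rwa [E.e_himp i hdS hbot, E.e_bot, le_himp_iff]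
  refine (inf_le_inf_right _ hbox).trans ?_
  rw [← E.e_inf i (hM.box_mem i hneg) (hM.dia_mem i hdS), ← E.e_bot i]
  exact E.e_mono i ((hS.side i).inf_mem (hM.box_mem i hneg) (hM.dia_mem i hdS)) hbot
    (ModalOps.box_inf_dia_le_bot hd himp_inf_le)

lemma boxMeet_le_bot (hC : M.Validates .Cbox) (hb : M.box ⊥ ≤ ⊥) {w : ∀ i, S i}
    (h : E.meet w ≤ ⊥) : E.boxMeet M w ≤ ⊥ := by
  have hbot := (hS.side true).bot_mem
  have := E.boxMeet_le_box hS hM hC hbot (h.trans bot_le)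
  rwa [le_bot_iff.1 hb, E.e_bot] at this

end

/-- The box and diamond on `H` for logics with `Cbox` and `Kdiam`. The box of `X` is generated by the
pairs of boxes, one from each side, whose arguments jointly imply `X`. The three meets in the
diamond of `X` are what monotonicity, `Kdiam` and `dualAnd`, respectively, impose as upper bounds;
the last two are guarded by boxes, so that they do not presuppose `Nbox`. -/
def regularOps : ModalOps H where
  box :=
    { toFun X := ⨆ (w : ∀ i, S i) (_ : E.meet w ≤ X), E.boxMeet M w
      monotone' X Y h := iSup_mono fun w => iSup_mono' fun h' => ⟨h'.trans h, le_rfl⟩ }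
  dia :=
    { toFun X :=
        (⨅ (i : Bool) (c : α) (_ : c ∈ S i ∧ X ≤ E.e i c), E.e i (M.dia c)) ⊓
        (⨅ (w : ∀ i, S i) (i : Bool) (c : α) (_ : c ∈ S i ∧ E.meet w ⊓ X ≤ E.e i c),
          E.boxMeet M w ⇨ E.e i (M.dia c)) ⊓
        ⨅ (w : ∀ i, S i) (_ : E.meet w ⊓ X ≤ ⊥), E.boxMeet M w ⇨ ⊥
      monotone' X Y h := by
        refine inf_le_inf (inf_le_inf ?_ ?_) ?_
        · exact iInf_mono fun i => iInf_mono fun c => iInf_mono' fun h' =>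
            ⟨⟨h'.1, h.trans h'.2⟩, le_rfl⟩
        · exact iInf_mono fun w => iInf_mono fun i => iInf_mono fun c => iInf_mono' fun h' =>
            ⟨⟨h'.1, (inf_le_inf_left _ h).trans h'.2⟩, le_rfl⟩
        · exact iInf_mono fun w => iInf_mono' fun h' =>
            ⟨(inf_le_inf_left _ h).trans h', le_rfl⟩ }

variable {M}

lemma regularOps_box_le {X Y : H} :
    (E.regularOps M).box X ≤ Y ↔ ∀ w : ∀ i, S i, E.meet w ≤ X → E.boxMeet M w ≤ Y := by
  change (⨆ (w : ∀ i, S i) (_ : E.meet w ≤ X), E.boxMeet M w) ≤ Y ↔ _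
  simp only [iSup_le_iff]

lemma boxMeet_le_regularOps {w : ∀ i, S i} {X : H} (h : E.meet w ≤ X) :
    E.boxMeet M w ≤ (E.regularOps M).box X :=
  E.regularOps_box_le.1 le_rfl w h

lemma le_regularOps_dia {X Y : H} :
    Y ≤ (E.regularOps M).dia X ↔
      (∀ i, ∀ c ∈ S i, X ≤ E.e i c → Y ≤ E.e i (M.dia c)) ∧
      (∀ (w : ∀ i, S i) (i), ∀ c ∈ S i, E.meet w ⊓ X ≤ E.e i c →
        Y ≤ E.boxMeet M w ⇨ E.e i (M.dia c)) ∧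
      ∀ w : ∀ i, S i, E.meet w ⊓ X ≤ ⊥ → Y ≤ E.boxMeet M w ⇨ ⊥ := by
  change Y ≤ (⨅ (i : Bool) (c : α) (_ : c ∈ S i ∧ X ≤ E.e i c), E.e i (M.dia c)) ⊓
        (⨅ (w : ∀ i, S i) (i : Bool) (c : α) (_ : c ∈ S i ∧ E.meet w ⊓ X ≤ E.e i c),
          E.boxMeet M w ⇨ E.e i (M.dia c)) ⊓
        (⨅ (w : ∀ i, S i) (_ : E.meet w ⊓ X ≤ ⊥), E.boxMeet M w ⇨ ⊥) ↔ _
  simp only [le_inf_iff, le_iInf_iff, and_imp, and_assoc]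

lemma regularOps_dia_le {X : H} {i : Bool} {c : α} (hc : c ∈ S i) (h : X ≤ E.e i c) :
    (E.regularOps M).dia X ≤ E.e i (M.dia c) :=
  (E.le_regularOps_dia.1 le_rfl).1 i c hc h

lemma boxMeet_inf_regularOps_dia_le {w : ∀ i, S i} {X : H} {i : Bool} {c : α} (hc : c ∈ S i)
    (h : E.meet w ⊓ X ≤ E.e i c) :
    E.boxMeet M w ⊓ (E.regularOps M).dia X ≤ E.e i (M.dia c) := by
  rw [inf_comm, ← le_himp_iff]
  exact (E.le_regularOps_dia.1 le_rfl).2.1 w i c hc h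

lemma boxMeet_inf_regularOps_dia_le_bot {w : ∀ i, S i} {X : H} (h : E.meet w ⊓ X ≤ ⊥) :
    E.boxMeet M w ⊓ (E.regularOps M).dia X ≤ ⊥ := by
  rw [inf_comm, ← le_himp_iff]
  exact (E.le_regularOps_dia.1 le_rfl).2.2 w h

lemma regularOps_extends (hS : IsSpan S C) (hM : M.Preserves S C) (hC : M.Validates .Cbox)
    (hK : M.Validates .Kdiam) (hd : M.Validates .dualAnd) :
    E.Extends M (E.regularOps M) := by
  refine fun i a ha => ⟨le_antisymm ?_ ?_, le_antisymm (E.regularOps_dia_le ha le_rfl) ?_⟩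
  · exact E.regularOps_box_le.2 fun w h => E.boxMeet_le_box hS hM hC ha h
  · refine le_trans (le_iInf fun j => ?_)
      (E.boxMeet_le_regularOps (w := single hS i ha) (E.iInf_single_le hS i ha))
    exact E.map_le_map hS M.box.monotone (fun _ => le_rfl) M.box.monotone
      (fun i _ => hM.box_mem i) (fun i _ => hM.box_mem i) (fun _ => hM.box_mem_common) ha
      (single hS i ha j).2 ((E.le_iInf_single hS i ha).trans (iInf_le _ j))
  · refine E.le_regularOps_dia.2 ⟨fun j c hc h => ?_, fun w j c hc h => ?_, fun w h => ?_⟩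
    · exact E.map_le_map hS M.dia.monotone (fun _ => le_rfl) M.dia.monotone
        (fun i _ => hM.dia_mem i) (fun i _ => hM.dia_mem i) (fun _ => hM.dia_mem_common) ha hc h
    · rw [le_himp_iff, inf_comm]
      exact E.boxMeet_inf_dia_le hS hM hC hK ha hc h
    · rw [le_himp_iff, inf_comm]
      exact E.boxMeet_inf_dia_le_bot hS hM hC hd ha h

/-- In the presence of `dualAnd`, `Cbox` and `Kdiam`, each modal axiom passes from the two sides to
their amalgam; for `Tdiam` this also uses `Tbox`. -/
lemma regularOps_validates (hS : IsSpan S C) (hM : M.Preserves S C) (hC : M.Validates .Cbox)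
    (hK : M.Validates .Kdiam) (hd : M.Validates .dualAnd) {ax : ModalAxiom}
    (hax : M.Validates ax) (hT : ax = .Tdiam → M.Validates .Tbox) :
    (E.regularOps M).Validates ax := by
  have box_le (hT : M.Validates .Tbox) (w : ∀ i, S i) : E.boxMeet M w ≤ E.meet w :=
    iInf_mono fun i => E.e_mono i (hM.box_mem i (w i).2) (w i).2 (hT _)
  cases ax with
  | dualAnd =>
    intro X
    rw [← le_himp_iff, E.regularOps_box_le]
    intro w h
    rw [le_himp_iff]
    exact E.boxMeet_inf_regularOps_dia_le_bot ((inf_le_inf_right _ h).trans inf_himp_le)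
  | Nbox =>
    change ⊤ ≤ M.box ⊤ at hax
    refine le_trans (le_iInf fun i => ?_)
      (E.boxMeet_le_regularOps (w := fun i => ⟨⊤, (hS.side i).top_mem⟩) le_top)
    change ⊤ ≤ E.e i (M.box ⊤)
    rw [top_le_iff.1 hax, E.e_top hS]
  | Cbox =>
    intro X Y
    rw [← le_himp_iff, E.regularOps_box_le]
    intro w h
    rw [le_himp_iff, inf_comm, ← le_himp_iff, E.regularOps_box_le]
    intro w' h'
    rw [le_himp_iff, inf_comm]
    refine (E.boxMeet_inf_le M hS hM hC w w').trans (E.boxMeet_le_regularOps ?_)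
    rw [E.meet_pointInf]
    exact inf_le_inf h h'
  | Kdiam =>
    intro X Y
    refine E.regularOps_box_le.2 fun w h => ?_
    have hX {Z : H} (hZ : Y ≤ Z) : E.meet w ⊓ X ≤ Z := (le_himp_iff.1 h).trans hZ
    have hX' {Z : H} {w' : ∀ i, S i} (hZ : E.meet w' ⊓ Y ≤ Z) :
        E.meet (pointInf hS w' w) ⊓ X ≤ Z := by
      rw [E.meet_pointInf, inf_assoc]
      exact (inf_le_inf_left _ (le_himp_iff.1 h)).trans hZ
    have hbox (w' : ∀ i, S i) : E.boxMeet M w ⊓ (E.regularOps M).dia X ⊓ E.boxMeet M w'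
        ≤ E.boxMeet M (pointInf hS w' w) ⊓ (E.regularOps M).dia X := by
      refine le_inf (le_trans ?_ (E.boxMeet_inf_le M hS hM hC w' w))
        (inf_le_left.trans inf_le_right)
      exact le_inf inf_le_right (inf_le_left.trans inf_le_left)
    rw [le_himp_iff]
    refine E.le_regularOps_dia.2 ⟨fun j c hc h' => ?_, fun w' j c hc h' => ?_, fun w' h' => ?_⟩
    · exact E.boxMeet_inf_regularOps_dia_le hc (hX h')
    · rw [le_himp_iff]
      exact (hbox w').trans (E.boxMeet_inf_regularOps_dia_le hc (hX' h'))
    · rw [le_himp_iff]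
      exact (hbox w').trans (E.boxMeet_inf_regularOps_dia_le_bot (hX' h'))
  | Pdiam =>
    have htop : M.dia ⊤ = ⊤ := top_le_iff.1 hax
    have hbot := ModalOps.box_bot_le hd (.inl hax)
    refine E.le_regularOps_dia.2 ⟨fun j c hc h => ?_, fun w j c hc h => ?_, fun w h => ?_⟩
    · have h' := E.map_le_map hS M.dia.monotone (fun _ => le_rfl) M.dia.monotone
        (fun i _ => hM.dia_mem i) (fun i _ => hM.dia_mem i) (fun _ => hM.dia_mem_common)
        (hS.side j).top_mem hc (le_top.trans h)
      rwa [htop, E.e_top hS] at h'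
    · have h' := E.boxMeet_inf_dia_le hS hM hC hK (hS.side j).top_mem hc
        ((inf_le_inf_left _ le_top).trans h)
      rw [htop, E.e_top hS] at h'
      rwa [le_himp_iff, inf_comm]
    · rw [le_himp_iff]
      exact inf_le_right.trans (E.boxMeet_le_bot hS hM hC hbot (by simpa using h))
  | D =>
    have hbot := ModalOps.box_bot_le hd (.inr hax)
    have key {w : ∀ i, S i} {j : Bool} {c : α} (hc : c ∈ S j) (h : E.meet w ≤ E.e j c) :
        E.boxMeet M w ≤ E.e j (M.dia c) :=
      (E.boxMeet_le_box hS hM hC hc h).trans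
        (E.e_mono j (hM.box_mem j hc) (hM.dia_mem j hc) (hax c))
    intro X
    refine E.regularOps_box_le.2 fun w h => E.le_regularOps_dia.2
      ⟨fun j c hc h' => key hc (h.trans h'), fun w' j c hc h' => ?_, fun w' h' => ?_⟩
    · rw [le_himp_iff, inf_comm]
      refine (E.boxMeet_inf_le M hS hM hC w' w).trans (key hc ?_)
      rw [E.meet_pointInf]
      exact (inf_le_inf_left _ h).trans h'
    · rw [le_himp_iff, inf_comm]
      refine (E.boxMeet_inf_le M hS hM hC w' w).trans (E.boxMeet_le_bot hS hM hC hbot ?_)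
      rw [E.meet_pointInf]
      exact (inf_le_inf_left _ h).trans h'
  | Tbox =>
    intro X
    exact E.regularOps_box_le.2 fun w h => (box_le hax w).trans h
  | Tdiam =>
    have hle (j) {c : α} (hc : c ∈ S j) : E.e j c ≤ E.e j (M.dia c) :=
      E.e_mono j hc (hM.dia_mem j hc) (hax c)
    intro X
    refine E.le_regularOps_dia.2
      ⟨fun j c hc h => h.trans (hle j hc), fun w j c hc h => ?_, fun w h => ?_⟩
    · rw [le_himp_iff, inf_comm]
      exact (inf_le_inf_right _ (box_le (hT rfl) w)).trans (h.trans (hle j hc))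
    · rw [le_himp_iff, inf_comm]
      exact (inf_le_inf_right _ (box_le (hT rfl) w)).trans h

end Regular

end Amalgam

/-! ### Lindenbaum algebras -/

namespace WLogic

open Formula

/-- `L.Entails A B`: the implication `A → B` is a theorem of `L`. -/
def Entails (L : WLogic) (A B : Formula) : Prop := L.Provable (imp A B)

namespace Entails

variable {L : WLogic} {A B C : Formula}

lemma weaken (h : L.Provable B) : L.Entails A B := .mp (.ipl (.k B A)) h

lemma mp (h₁ : L.Entails C (imp A B)) (h₂ : L.Entails C A) : L.Entails C B :=
  Provable.mp (Provable.mp (.ipl (.s C A B)) h₁) h₂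

lemma refl (A : Formula) : L.Entails A A :=
  mp (B := A) (A := imp A A) (.ipl (.k A (imp A A))) (.ipl (.k A A))

lemma trans (h₁ : L.Entails A B) (h₂ : L.Entails B C) : L.Entails A C := mp (weaken h₂) h₁

lemma and_intro (h₁ : L.Entails C A) (h₂ : L.Entails C B) : L.Entails C (and A B) :=
  mp (trans h₁ (.ipl (.andIntro A B))) h₂

lemma or_elim (h₁ : L.Entails A C) (h₂ : L.Entails B C) : L.Entails (or A B) C :=
  Provable.mp (Provable.mp (.ipl (.orElim A B C)) h₁) h₂

lemma imp_iff : L.Entails A (imp B C) ↔ L.Entails (and A B) C :=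
  ⟨fun h => mp (trans (.ipl (.andLeft A B)) h) (.ipl (.andRight A B)),
    fun h => trans (.ipl (.andIntro A B)) (Provable.mp (.ipl (.s B (and A B) C)) (weaken h))⟩

end Entails

lemma provable_top (L : WLogic) : L.Provable top := Entails.refl bot

/-- Provable equivalence in `L`. -/
def equivalence (L : WLogic) : Setoid Formula where
  r A B := L.Entails A B ∧ L.Entails B A
  iseqv := ⟨fun A => ⟨.refl A, .refl A⟩, And.symm, fun h₁ h₂ => ⟨h₁.1.trans h₂.1, h₂.2.trans h₁.2⟩⟩

/-- The Lindenbaum algebra of `L`: formulas modulo provable equivalence. -/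
def Lindenbaum (L : WLogic) : Type := Quotient L.equivalence

/-- The class of a formula in the Lindenbaum algebra. -/
def toLindenbaum (L : WLogic) (A : Formula) : L.Lindenbaum := Quotient.mk L.equivalence A

lemma and_mono {L : WLogic} {A A' B B' : Formula} (h₁ : L.Entails A A') (h₂ : L.Entails B B') :
    L.Entails (and A B) (and A' B') :=
  .and_intro (.trans (.ipl (.andLeft A B)) h₁) (.trans (.ipl (.andRight A B)) h₂)

lemma or_mono {L : WLogic} {A A' B B' : Formula} (h₁ : L.Entails A A') (h₂ : L.Entails B B') :
    L.Entails (or A B) (or A' B') :=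
  .or_elim (h₁.trans (.ipl (.orLeft A' B'))) (h₂.trans (.ipl (.orRight A' B')))

lemma imp_mono {L : WLogic} {A A' B B' : Formula} (h₁ : L.Entails A' A) (h₂ : L.Entails B B') :
    L.Entails (imp A B) (imp A' B') :=
  Entails.imp_iff.2 (((and_mono (.refl _) h₁).trans (Entails.imp_iff.1 (.refl _))).trans h₂)

instance (L : WLogic) : HeytingAlgebra L.Lindenbaum where
  le := Quotient.lift₂ L.Entails fun _ _ _ _ h₁ h₂ => propext
    ⟨fun h => (h₁.2.trans h).trans h₂.1, fun h => (h₁.1.trans h).trans h₂.2⟩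
  le_refl := by rintro ⟨A⟩; exact .refl A
  le_trans := by rintro ⟨A⟩ ⟨B⟩ ⟨C⟩ h₁ h₂; exact Entails.trans h₁ h₂
  le_antisymm := by rintro ⟨A⟩ ⟨B⟩ h₁ h₂; exact Quotient.sound ⟨h₁, h₂⟩
  inf := Quotient.map₂ and fun _ _ h₁ _ _ h₂ => ⟨and_mono h₁.1 h₂.1, and_mono h₁.2 h₂.2⟩
  inf_le_left := by rintro ⟨A⟩ ⟨B⟩; exact .ipl (.andLeft A B)
  inf_le_right := by rintro ⟨A⟩ ⟨B⟩; exact .ipl (.andRight A B)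
  le_inf := by rintro ⟨A⟩ ⟨B⟩ ⟨C⟩ h₁ h₂; exact Entails.and_intro h₁ h₂
  sup := Quotient.map₂ or fun _ _ h₁ _ _ h₂ => ⟨or_mono h₁.1 h₂.1, or_mono h₁.2 h₂.2⟩
  le_sup_left := by rintro ⟨A⟩ ⟨B⟩; exact .ipl (.orLeft A B)
  le_sup_right := by rintro ⟨A⟩ ⟨B⟩; exact .ipl (.orRight A B)
  sup_le := by rintro ⟨A⟩ ⟨B⟩ ⟨C⟩ h₁ h₂; exact Entails.or_elim h₁ h₂
  himp := Quotient.map₂ imp fun _ _ h₁ _ _ h₂ => ⟨imp_mono h₁.2 h₂.1, imp_mono h₁.1 h₂.2⟩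
  le_himp_iff := by rintro ⟨A⟩ ⟨B⟩ ⟨C⟩; exact Entails.imp_iff
  top := L.toLindenbaum top
  le_top := by rintro ⟨A⟩; exact Entails.weaken L.provable_top
  bot := L.toLindenbaum bot
  bot_le := by rintro ⟨A⟩; exact .ipl (.exFalso A)
  compl := Quotient.map neg fun _ _ h => ⟨imp_mono h.2 (.refl _), imp_mono h.1 (.refl _)⟩
  himp_bot := by rintro ⟨A⟩; rfl

/-- Box and diamond on the Lindenbaum algebra. -/
def lindenbaumOps (L : WLogic) : ModalOps L.Lindenbaum where
  box :=
    { toFun := Quotient.map box fun _ _ h => ⟨.monBox h.1, .monBox h.2⟩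
      monotone' := by rintro ⟨A⟩ ⟨B⟩ h; exact Provable.monBox h }
  dia :=
    { toFun := Quotient.map diam fun _ _ h => ⟨.monDiam h.1, .monDiam h.2⟩
      monotone' := by rintro ⟨A⟩ ⟨B⟩ h; exact Provable.monDiam h }

lemma lindenbaumOps_validates (L : WLogic) {ax : ModalAxiom} (hax : ax ∈ L.modalAxioms) :
    L.lindenbaumOps.Validates ax := by
  cases ax with
  | dualAnd => rintro ⟨A⟩; exact Provable.modal hax (.dualAnd A)
  | Nbox => exact Entails.weaken (Provable.modal hax .Nbox)
  | Cbox => rintro ⟨A⟩ ⟨B⟩; exact Provable.modal hax (.Cbox A B)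
  | Kdiam => rintro ⟨A⟩ ⟨B⟩; exact Provable.modal hax (.Kdiam A B)
  | Pdiam => exact Entails.weaken (Provable.modal hax .Pdiam)
  | D => rintro ⟨A⟩; exact Provable.modal hax (.D A)
  | Tbox => rintro ⟨A⟩; exact Provable.modal hax (.Tbox A)
  | Tdiam => rintro ⟨A⟩; exact Provable.modal hax (.Tdiam A)

/-- The classes of the formulas over a set of variables. -/
def fragment (L : WLogic) (P : Set ℕ) : Set L.Lindenbaum :=
  {a | ∃ A, A.atoms ⊆ P ∧ L.toLindenbaum A = a}

lemma toLindenbaum_mem_fragment (L : WLogic) {P : Set ℕ} {A : Formula} (h : A.atoms ⊆ P) :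
    L.toLindenbaum A ∈ L.fragment P := ⟨A, h, rfl⟩

lemma isHeytingSub_fragment (L : WLogic) (P : Set ℕ) : IsHeytingSub (L.fragment P) where
  bot_mem := ⟨bot, Set.empty_subset _, rfl⟩
  inf_mem := by
    rintro _ _ ⟨A, hA, rfl⟩ ⟨B, hB, rfl⟩; exact ⟨and A B, Set.union_subset hA hB, rfl⟩
  sup_mem := by
    rintro _ _ ⟨A, hA, rfl⟩ ⟨B, hB, rfl⟩; exact ⟨or A B, Set.union_subset hA hB, rfl⟩
  himp_mem := by
    rintro _ _ ⟨A, hA, rfl⟩ ⟨B, hB, rfl⟩; exact ⟨imp A B, Set.union_subset hA hB, rfl⟩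

lemma box_mem_fragment (L : WLogic) {P : Set ℕ} {a : L.Lindenbaum} (ha : a ∈ L.fragment P) :
    L.lindenbaumOps.box a ∈ L.fragment P := by
  obtain ⟨A, hA, rfl⟩ := ha; exact ⟨box A, hA, rfl⟩

lemma dia_mem_fragment (L : WLogic) {P : Set ℕ} {a : L.Lindenbaum} (ha : a ∈ L.fragment P) :
    L.lindenbaumOps.dia a ∈ L.fragment P := by
  obtain ⟨A, hA, rfl⟩ := ha; exact ⟨diam A, hA, rfl⟩

lemma isSpan_fragment (L : WLogic) (P : Bool → Set ℕ) :
    IsSpan (fun i => L.fragment (P i)) (L.fragment (⋂ i, P i)) where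
  side i := L.isHeytingSub_fragment (P i)
  common := L.isHeytingSub_fragment _
  subset i := by
    rintro _ ⟨A, hA, rfl⟩; exact ⟨A, hA.trans (Set.iInter_subset P i), rfl⟩

lemma preserves_fragment (L : WLogic) (P : Bool → Set ℕ) :
    L.lindenbaumOps.Preserves (fun i => L.fragment (P i)) (L.fragment (⋂ i, P i)) where
  box_mem _ _ := L.box_mem_fragment
  dia_mem _ _ := L.dia_mem_fragment
  box_mem_common := L.box_mem_fragment
  dia_mem_common := L.dia_mem_fragment

end WLogic

/-! ### Algebraic semantics -/

namespace Formula

variable {H : Type*} [HeytingAlgebra H]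

/-- The value of a formula in a Heyting algebra with modal operators. -/
def value (N : ModalOps H) (v : ℕ → H) : Formula → H
  | atom p => v p
  | bot => ⊥
  | and A B => A.value N v ⊓ B.value N v
  | or A B => A.value N v ⊔ B.value N v
  | imp A B => A.value N v ⇨ B.value N v
  | box A => N.box (A.value N v)
  | diam A => N.dia (A.value N v)

end Formula

namespace WLogic

open Formula

/-- Soundness of the algebraic semantics. -/
theorem Provable.value_eq_top {H : Type*} [HeytingAlgebra H] {L : WLogic} {N : ModalOps H}
    (hN : ∀ ax ∈ L.modalAxioms, N.Validates ax) (v : ℕ → H) {A : Formula} (h : L.Provable A) :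
    A.value N v = ⊤ := by
  induction h with
  | ipl h =>
    cases h with
    | k A B => simp [value]
    | s A B C =>
      simp only [value, himp_eq_top_iff, le_himp_iff]
      set a := A.value N v
      set b := B.value N v
      set c := C.value N v
      calc (a ⇨ b ⇨ c) ⊓ (a ⇨ b) ⊓ a ≤ (b ⇨ c) ⊓ b := by
            refine le_inf ?_ ?_
            · exact (inf_le_inf_right _ inf_le_left).trans himp_inf_le
            · exact (inf_le_inf_right _ inf_le_right).trans himp_inf_le
        _ ≤ c := himp_inf_le
    | andLeft A B => simp [value]
    | andRight A B => simp [value]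
    | andIntro A B => simp [value]
    | orLeft A B => simp [value]
    | orRight A B => simp [value]
    | orElim A B C =>
      simp only [value, himp_eq_top_iff, le_himp_iff]
      rw [inf_sup_left]
      exact sup_le ((inf_le_inf_right _ inf_le_left).trans himp_inf_le)
        ((inf_le_inf_right _ inf_le_right).trans himp_inf_le)
    | exFalso A => simp [value]
  | modal hax h =>
    have := hN _ hax
    cases h with
    | dualAnd A => exact himp_eq_top_iff.2 (this _)
    | Nbox =>
      have htop : top.value N v = ⊤ := himp_self
      exact top_le_iff.1 (this.trans_eq (congrArg N.box htop.symm))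
    | Cbox A B => exact himp_eq_top_iff.2 (this _ _)
    | Kdiam A B => exact himp_eq_top_iff.2 (this _ _)
    | Pdiam =>
      have htop : top.value N v = ⊤ := himp_self
      exact top_le_iff.1 (this.trans_eq (congrArg N.dia htop.symm))
    | D A => exact himp_eq_top_iff.2 (this _)
    | Tbox A => exact himp_eq_top_iff.2 (this _)
    | Tdiam A => exact himp_eq_top_iff.2 (this _)
  | mp _ _ ih₁ ih₂ => simpa [value, ih₂] using ih₁
  | monBox _ ih => exact himp_eq_top_iff.2 (N.box.monotone (himp_eq_top_iff.1 ih))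
  | monDiam _ ih => exact himp_eq_top_iff.2 (N.dia.monotone (himp_eq_top_iff.1 ih))

/-! ### Interpolation -/

lemma dualAnd_mem (L : WLogic) : ModalAxiom.dualAnd ∈ L.modalAxioms := by
  cases L <;> simp [modalAxioms]

lemma Kdiam_mem_iff (L : WLogic) :
    ModalAxiom.Kdiam ∈ L.modalAxioms ↔ ModalAxiom.Cbox ∈ L.modalAxioms := by
  cases L <;> simp [modalAxioms]

lemma Tbox_mem (L : WLogic) (h : ModalAxiom.Tdiam ∈ L.modalAxioms) :
    ModalAxiom.Tbox ∈ L.modalAxioms := by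
  cases L <;> simp [modalAxioms] at h ⊢

/-- Modal operators on an amalgam of two fragments that make it a model of the logic. -/
lemma exists_modalOps (L : WLogic) (P : Bool → Set ℕ) {H : Type*} [Order.Frame H]
    (E : Amalgam (fun i => L.fragment (P i)) (L.fragment (⋂ i, P i)) H) :
    ∃ N : ModalOps H, E.Extends L.lindenbaumOps N ∧ ∀ ax ∈ L.modalAxioms, N.Validates ax := by
  have hS := L.isSpan_fragment P
  have hM := L.preserves_fragment P
  have hL {ax} (h : ax ∈ L.modalAxioms) := L.lindenbaumOps_validates h
  by_cases hC : ModalAxiom.Cbox ∈ L.modalAxioms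
  · have hK := L.Kdiam_mem_iff.2 hC
    have hd := L.dualAnd_mem
    refine ⟨E.regularOps L.lindenbaumOps,
      E.regularOps_extends hS hM (hL hC) (hL hK) (hL hd), fun ax hax => ?_⟩
    exact E.regularOps_validates hS hM (hL hC) (hL hK) (hL hd) (hL hax)
      fun h => hL (L.Tbox_mem (h ▸ hax))
  · refine ⟨E.monotoneOps L.lindenbaumOps, E.monotoneOps_extends hS hM, fun ax hax => ?_⟩
    refine E.monotoneOps_validates hS hM ?_ ?_ (hL hax)
    · rintro rfl
      exact hC hax
    · rintro rfl
      exact hC (L.Kdiam_mem_iff.1 hax)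

/-- On the formulas over `P i`, the value in the amalgam is the embedding of side `i`. -/
lemma value_eq_e (L : WLogic) (P : Bool → Set ℕ) {H : Type*} [Order.Frame H]
    (E : Amalgam (fun i => L.fragment (P i)) (L.fragment (⋂ i, P i)) H) {N : ModalOps H}
    (hN : E.Extends L.lindenbaumOps N) {v : ℕ → H}
    (hv : ∀ i, ∀ p ∈ P i, v p = E.e i (L.toLindenbaum (atom p))) (i : Bool) {A : Formula}
    (hA : A.atoms ⊆ P i) : A.value N v = E.e i (L.toLindenbaum A) := by
  have mem {B : Formula} (hB : B.atoms ⊆ P i) : L.toLindenbaum B ∈ L.fragment (P i) :=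
    L.toLindenbaum_mem_fragment hB
  induction A with
  | atom p => exact hv i p (hA rfl)
  | bot => exact (E.e_bot i).symm
  | and A B ihA ihB =>
    obtain ⟨hA, hB⟩ := Set.union_subset_iff.1 hA
    rw [value, ihA hA, ihB hB]
    exact (E.e_inf i (mem hA) (mem hB)).symm
  | or A B ihA ihB =>
    obtain ⟨hA, hB⟩ := Set.union_subset_iff.1 hA
    rw [value, ihA hA, ihB hB]
    exact (E.e_sup i (mem hA) (mem hB)).symm
  | imp A B ihA ihB =>
    obtain ⟨hA, hB⟩ := Set.union_subset_iff.1 hA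
    rw [value, ihA hA, ihB hB]
    exact (E.e_himp i (mem hA) (mem hB)).symm
  | box A ih =>
    rw [value, ih hA]
    exact (hN i _ (mem (B := A) hA)).1
  | diam A ih =>
    rw [value, ih hA]
    exact (hN i _ (mem (B := A) hA)).2

theorem exists_interpolant (L : WLogic) {A B : Formula} (h : L.Provable (imp A B)) :
    ∃ I : Formula, L.Provable (imp A I) ∧ L.Provable (imp I B) ∧ I.atoms ⊆ A.atoms ∩ B.atoms := by
  classical
  let P : Bool → Set ℕ := fun i => bif i then A.atoms else B.atoms
  have hS := L.isSpan_fragment P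
  let E := spanAmalgam hS
  obtain ⟨N, hN, hval⟩ := L.exists_modalOps P E
  let v (p : ℕ) := E.e (decide (p ∈ A.atoms)) (L.toLindenbaum (atom p))
  have hv (i : Bool) (p : ℕ) (hp : p ∈ P i) : v p = E.e i (L.toLindenbaum (atom p)) := by
    by_cases hpA : p ∈ A.atoms <;> cases i
    · -- a common variable: the two embeddings agree
      refine E.e_common _ _ (L.toLindenbaum_mem_fragment ?_)
      refine Set.singleton_subset_iff.2 (Set.mem_iInter.2 fun j => ?_)
      cases j
      exacts [hp, hpA]
    · simp [v, hpA]
    · simp [v, hpA]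
    · exact absurd hp hpA
  have hle := himp_eq_top_iff.1 (h.value_eq_top hval v)
  rw [L.value_eq_e P E hN hv true subset_rfl, L.value_eq_e P E hN hv false subset_rfl] at hle
  have hA : L.toLindenbaum A ∈ L.fragment (P true) := L.toLindenbaum_mem_fragment subset_rfl
  obtain ⟨_, ⟨I, hI, rfl⟩, h₁, h₂⟩ := E.interpolant (Amalgam.single hS true hA) false
    (L.toLindenbaum_mem_fragment subset_rfl) ((E.iInf_single_le hS true hA).trans hle)
  have h₁' : L.toLindenbaum A ≤ L.toLindenbaum I := h₁
  have h₂' : L.toLindenbaum I ≤ L.toLindenbaum B := by simpa [Amalgam.single] using h₂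
  -- the order of the Lindenbaum algebra is provable implication by definition
  exact ⟨I, h₁', h₂', Set.subset_inter (hI.trans (Set.iInter_subset P true))
    (hI.trans (Set.iInter_subset P false))⟩

end WLogic

end WLogics

theorem mainTheorem5 (L : WLogics.WLogic) : L.EnjoysCraigInterpolation := by
  intro A B h
  obtain ⟨I, h₁, h₂, hI⟩ := L.exists_interpolant h
  refine ⟨I, h₁, h₂, Set.union_subset ?_ ?_⟩
  · exact Set.subset_inter Set.subset_union_left Set.subset_union_left
  · rintro _ ⟨p, hp, rfl⟩
    exact ⟨.inr ⟨p, (hI hp).1, rfl⟩, .inr ⟨p, (hI hp).2, rfl⟩⟩
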